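/- Let $q=2^m$ with $m\ge 1$, let $k\ge 0$ be an integer, $d=\gcd(k,m)$ and $\sigma=2^k$. Two maps $F,G\colon \mathbb F_q^3\to\mathbb F_q^3$ are called linearly equivalent if $L_1\circ F\circ L_2=G$ for some invertible $\mathbb F_2$-linear maps $L_1,L_2$ of $\mathbb F_q^3$. The differential uniformity of $F$ is $\max_{u\neq 0,\,v}\#\{w\in\mathbb F_q^3: F(w+u)-F(w)=v\}$. For $a,b,c\in\mathbb F_q$ let $$G_{\sigma,a,b,c}(x,y,z)=\bigl(x^{\sigma+1}+ay^{\sigma}z+bx^{\sigma}y+cx^{\sigma}z,\; ay^{\sigma+1}+z^{\sigma}x+bz^{\sigma}y+cx^{\sigma}y,\; z^{\sigma+1}+x^{\sigma}y\bigr),$$ and let $\mathcal G_{a,b,c}$ (for $a\ne 0$) be the family of all maps $G_{2^{j},a,b,c}$ with $1\le j<m$ such that, with $\tau=2^j$, the equation $ax^{\tau^2+\tau+1}+bx^{\tau+1}+cx+1=0$ has no solution $x\in\mathbb F_q$. The first family of Li and Kaleyski consists of the maps $$F_\sigma(x,y,z)=(x^{\sigma+1}+x^{\sigma}z+yz^{\sigma},\;x^{\sigma}z+y^{\sigma+1},\;xy^{\sigma}+y^{\sigma}z+z^{\sigma+1})$$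 for which the following conditions (LK) hold: the polynomials $X^{\sigma^2+\sigma+1}+X+1$, $X^{\sigma^2+\sigma+1}+X^{\sigma^2}+1$ and $X^{\sigma^2+\sigma+1}+X^{\sigma^2+1}+X^{\sigma+1}+X+1$ have no roots in $\mathbb F_q$, and $X^{\sigma^2+\sigma+1}+XY^{\sigma^2+\sigma}+XY^{\sigma}+X^{\sigma^2+\sigma}+X^{\sigma}Y^{\sigma^2}+X^{\sigma^2}Y+Y^{\sigma^2+\sigma+1}+Y^{\sigma^2+\sigma}+Y^{\sigma^2}+Y^{\sigma}+1$ has no zero in $\mathbb F_q^2$. Consider the single condition (S): $X^{\sigma^2+\sigma+1}+X^{\sigma^2}+1$ has no root in $\mathbb F_q$. Then: 1. $F_\sigma$ is linearly equivalent to $G_{\sigma,1,1,0}$. 2. (LK) implies (S). 3. If (S) holds and $m\nmid k$ (that is, $x\mapsto x^\sigma$ is not the identity on $\mathbb F_q$), then $F_\sigma$ is linearly equivalent to a member of the family $\mathcal G_{1,1,0}$. In particular this applies to every function of Li and Kaleyski's first family with $m\nmid k$. 4. If (S) holds, then the differential uniformity of $F_\sigma$ is $2^d$. -/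

import Mathlib

namespace Triprojective

open Classical in
/-- The entry `#{x | F (x + u) - F x = v}` of the difference distribution table of `F`. -/
noncomputable def ddt {V : Type*} [AddCommGroup V] [Fintype V] (F : V → V) (u v : V) : ℕ :=
  (Finset.univ.filter fun x : V => F (x + u) - F x = v).card

open Classical in
/-- The differential uniformity of `F`: the maximum of `ddt F u v` over all `u ≠ 0` and all `v`. -/
noncomputable def differentialUniformity {V : Type*} [AddCommGroup V] [Fintype V]
    (F : V → V) : ℕ :=
  (Finset.univ.filter fun w : V × V => w.1 ≠ 0).sup fun w => ddt F w.1 w.2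

/-- Linear equivalence over the prime field `𝔽₂`: `L₁ ∘ F ∘ L₂ = G` with `L₁`, `L₂` invertible
`𝔽₂`-linear maps. -/
def LinearlyEquivalent {V : Type*} [AddCommGroup V] [Module (ZMod 2) V] (F G : V → V) : Prop :=
  ∃ L₁ L₂ : V ≃ₗ[ZMod 2] V, ⇑L₁ ∘ F ∘ ⇑L₂ = G

section Families

variable {K : Type*} [Field K]

/-- The trivariate map with parameters `a b c` and exponent `s` (in characteristic two). -/
def mainMap (s : ℕ) (a b c : K) : K × K × K → K × K × K := fun (x, y, z) =>
  (x ^ (s + 1) + a * y ^ s * z + b * x ^ s * y + c * x ^ s * z,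
    a * y ^ (s + 1) + z ^ s * x + b * z ^ s * y + c * x ^ s * y,
    z ^ (s + 1) + x ^ s * y)

/-- The condition that `a X^(s²+s+1) + b X^(s+1) + c X + 1` has no root in the field. -/
def MainCondition (s : ℕ) (a b c : K) : Prop :=
  ∀ x : K, a * x ^ (s ^ 2 + s + 1) + b * x ^ (s + 1) + c * x + 1 ≠ 0

/-- The family of maps `mainMap (2 ^ k) a b c` over the field with `2 ^ m` elements, for fixed
`a`, `b`, `c`: one takes `1 ≤ k < m`, requires `a ≠ 0`, and imposes the no-root condition. -/
def mainFamily (m : ℕ) (a b c : K) : Set (K × K × K → K × K × K) :=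
  {F | ∃ k : ℕ, 1 ≤ k ∧ k < m ∧ a ≠ 0 ∧ MainCondition (2 ^ k) a b c ∧ F = mainMap (2 ^ k) a b c}

variable (K) in
/-- The trivariate map of the first family of Li and Kaleyski, with exponent `s`. -/
def liKaleyskiMap (s : ℕ) : K × K × K → K × K × K := fun (x, y, z) =>
  (x ^ (s + 1) + x ^ s * z + y * z ^ s,
    x ^ s * z + y ^ (s + 1),
    x * y ^ s + y ^ s * z + z ^ (s + 1))

variable (K) in
/-- The single condition: `X^(s²+s+1) + X^(s²) + 1` has no root in `K`. -/
def SingleCondition (s : ℕ) : Prop :=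
  ∀ x : K, x ^ (s ^ 2 + s + 1) + x ^ (s ^ 2) + 1 ≠ 0

variable (K) in
/-- The four conditions that Li and Kaleyski impose on their first family. -/
def LiKaleyskiConditions (s : ℕ) : Prop :=
  (∀ x : K, x ^ (s ^ 2 + s + 1) + x + 1 ≠ 0) ∧
  (∀ x : K, x ^ (s ^ 2 + s + 1) + x ^ (s ^ 2) + 1 ≠ 0) ∧
  (∀ x : K, x ^ (s ^ 2 + s + 1) + x ^ (s ^ 2 + 1) + x ^ (s + 1) + x + 1 ≠ 0) ∧
  (∀ x y : K, x ^ (s ^ 2 + s + 1) + x * y ^ (s ^ 2 + s) + x * y ^ s + x ^ (s ^ 2 + s)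
    + x ^ s * y ^ (s ^ 2) + x ^ (s ^ 2) * y + y ^ (s ^ 2 + s + 1) + y ^ (s ^ 2 + s)
    + y ^ (s ^ 2) + y ^ s + 1 ≠ 0)

end Families

end Triprojective

namespace Triprojective

/-! Swapping the last two coordinates on both sides gives the equivalence, and inverting the
variable matches the two no-root conditions. For the uniformity, the map is quadratic, so it
suffices to find the `U` annihilated by `u` under the polar form. The 2×2 minors of `(u, U)` satisfy
semilinear relations: if they are not all zero, a quotient of two of them is a root of `X^(σ²+σ+1) +
X + 1`, which trace duality turns into a root excluded by (S). Hence `U = c • u`, and (S) again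
forces `σ c = c`. -/

/-- Transposition of the last two coordinates, as an `R`-linear automorphism. -/
def swapLastTwo (R M : Type*) [Semiring R] [AddCommMonoid M] [Module R M] :
    (M × M × M) ≃ₗ[R] (M × M × M) :=
  (LinearEquiv.refl R M).prodCongr (LinearEquiv.prodComm R M M)

theorem liKaleyskiMap_linearlyEquivalent_mainMap {K : Type*} [Field K] [Algebra (ZMod 2) K]
    (s : ℕ) : LinearlyEquivalent (liKaleyskiMap K s) (mainMap s (1 : K) 1 0) := by
  refine ⟨swapLastTwo (ZMod 2) K, swapLastTwo (ZMod 2) K, ?_⟩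
  funext ⟨x, y, z⟩
  simp only [swapLastTwo, liKaleyskiMap, mainMap, Function.comp_apply,
    LinearEquiv.prodCongr_apply, LinearEquiv.refl_apply, LinearEquiv.prodComm_apply,
    Prod.swap_prod_mk, Prod.mk.injEq]
  refine ⟨by ring, by ring, by ring⟩

/-! ### Inverting the variable, and exponents inducing the same power map. -/

section Exponents

variable {K : Type*} [Field K]

/-- Substituting `x⁻¹` turns the single condition into the condition of the main family. -/
theorem SingleCondition.mainCondition {s : ℕ} (h : SingleCondition K s) :
    MainCondition s (1 : K) 1 0 := by
  intro x hx
  have hx0 : x ≠ 0 := by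
    rintro rfl
    simp at hx
  refine h x⁻¹ ?_
  have e : s ^ 2 + s + 1 = s ^ 2 + (s + 1) := by ring
  rw [e, pow_add] at hx ⊢
  have h1 : x ^ s ^ 2 ≠ 0 := pow_ne_zero _ hx0
  have h2 : x ^ (s + 1) ≠ 0 := pow_ne_zero _ hx0
  simp only [inv_pow]
  field_simp
  linear_combination hx

theorem SingleCondition.congr {s t : ℕ} (hst : ∀ x : K, x ^ s = x ^ t)
    (h : SingleCondition K s) : SingleCondition K t := by
  intro x hx
  refine h x ?_
  have h2 : x ^ s ^ 2 = x ^ t ^ 2 := by rw [sq, pow_mul, hst, hst, ← pow_mul, ← sq]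
  rw [pow_succ, pow_add, h2, hst]
  rw [pow_succ, pow_add] at hx
  exact hx

theorem liKaleyskiMap_congr {s t : ℕ} (hst : ∀ x : K, x ^ s = x ^ t) :
    liKaleyskiMap K s = liKaleyskiMap K t := by
  funext ⟨x, y, z⟩
  simp only [liKaleyskiMap, pow_succ, hst]

end Exponents

/-! ### Fixed fields of Frobenius powers. -/

section FiniteField

variable {K : Type*} [Field K] [Fintype K]

theorem pow_two_pow_mod {m : ℕ} (hK : Fintype.card K = 2 ^ m) (k : ℕ) (x : K) :
    x ^ 2 ^ k = x ^ 2 ^ (k % m) := by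
  conv_lhs => rw [← Nat.mod_add_div k m, pow_add, pow_mul, pow_mul 2 m, ← hK]
  exact FiniteField.pow_card_pow _ _

open Classical in
/-- The fixed field of the `k`-th power of the Frobenius has `2 ^ gcd (k, m)` elements. -/
theorem card_filter_pow_two_pow_eq_self {m : ℕ} (hK : Fintype.card K = 2 ^ m) (k : ℕ) :
    (Finset.univ.filter fun c : K => c ^ 2 ^ k = c).card = 2 ^ Nat.gcd k m := by
  -- Nonzero fixed points are the `(2 ^ k - 1)`-th roots of unity in a cyclic group of order `2 ^ m
  -- - 1`.
  have hker := IsCyclic.card_powMonoidHom_ker Kˣ (2 ^ k - 1)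
  rw [Nat.card_units, Nat.card_eq_fintype_card (α := K), hK, Nat.gcd_comm,
    Nat.pow_sub_one_gcd_pow_sub_one] at hker
  have hpos : ∀ n : ℕ, 1 ≤ 2 ^ n := fun n => Nat.one_le_two_pow
  have himg : (Finset.univ.filter fun c : K => c ^ 2 ^ k = c) =
      insert 0 ((Finset.univ.filter fun c : Kˣ => c ^ (2 ^ k - 1) = 1).map
        ⟨Units.val, Units.val_injective⟩) := by
    ext c
    simp only [Finset.mem_filter, Finset.mem_univ, true_and, Finset.mem_insert, Finset.mem_map,
      Function.Embedding.coeFn_mk]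
    have key : ∀ c : K, c ^ 2 ^ k = c ^ (2 ^ k - 1) * c := fun c => by
      rw [← pow_succ, Nat.sub_add_cancel (hpos k)]
    constructor
    · intro h
      rcases eq_or_ne c 0 with h0 | h0
      · exact Or.inl h0
      · refine Or.inr ⟨Units.mk0 c h0, ?_, rfl⟩
        ext
        rw [key] at h
        simpa using mul_right_cancel₀ h0 (h.trans (one_mul c).symm)
    · rintro (rfl | ⟨u, hu, rfl⟩)
      · simp
      · rw [key, ← Units.val_pow_eq_pow_val, hu]
        simp
  rw [himg, Finset.card_insert_of_notMem (by simp), Finset.card_map]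
  have : (Finset.univ.filter fun c : Kˣ => c ^ (2 ^ k - 1) = 1).card =
      Nat.card (powMonoidHom (α := Kˣ) (2 ^ k - 1)).ker := by
    rw [← Fintype.card_subtype, ← Nat.card_eq_fintype_card]
    rfl
  rw [this, hker, Nat.sub_add_cancel (hpos _)]

/-! ### Trace duality and the polar form. -/

variable [Algebra (ZMod 2) K]

/-- Trace duality: if `X^(σ²+σ+1) + X + 1` has a root, then so has `X^(σ²+σ+1) + X^(σ²) + 1`. -/
theorem exists_root_of_exists_dual_root (σ : K ≃ₐ[ZMod 2] K) {s : K}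
    (hs : σ (σ s) * σ s * s + s + 1 = 0) :
    ∃ x : K, σ (σ x) * σ x * x + σ (σ x) + 1 = 0 := by
  have hs0 : s ≠ 0 := by
    rintro rfl
    simp at hs
  obtain ⟨c, rfl⟩ : ∃ c : K, s = c⁻¹ := ⟨s⁻¹, (inv_inv s).symm⟩
  have hc0 : c ≠ 0 := by simpa using hs0
  have hc1 : σ c ≠ 0 := by simpa using hc0
  have hc2 : σ (σ c) ≠ 0 := by simpa using hc0
  have hc : 1 + σ (σ c) * σ c + σ (σ c) * σ c * c = 0 := by
    simp only [map_inv₀] at hs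
    field_simp at hs
    linear_combination hs
  let T := Algebra.trace (ZMod 2) K
  have hT : ∀ y, T (σ y) = T y := fun y => Algebra.trace_eq_of_algEquiv σ y
  -- `L` is chosen so that its trace adjoint kills `1`, which is `hc` up to a power of `σ`, while
  -- its nonzero kernel elements `y` yield the wanted roots `y / (c * σ y)`.
  let L : K →ₗ[ZMod 2] K :=
    { toFun := fun y => y + σ c * c * σ (σ y) + σ (σ c) * σ c * c * σ (σ (σ y))
      map_add' := fun y z => by simp only [map_add]; ring
      map_smul' := fun r y => by
        simp only [map_smul, RingHom.id_apply, smul_add, mul_smul_comm] }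
  have hL : ∀ y, T (L y) = 0 := by
    intro y
    have e : T (L y) = T (σ (σ (σ y)) + σ (σ c * c * σ (σ y)) +
        σ (σ c) * σ c * c * σ (σ (σ y))) := by
      simp only [L, LinearMap.coe_mk, AddHom.coe_mk, map_add, hT]
    have e' : σ (σ (σ y)) + σ (σ c * c * σ (σ y)) + σ (σ c) * σ c * c * σ (σ (σ y)) = 0 := by
      simp only [map_mul]
      linear_combination σ (σ (σ y)) * hc
    rw [e, e', map_zero]
  -- The image lies in the kernel of the nonzero trace, so `L` is not surjective and, by finiteness,
  -- not injective.
  have hnot : ¬ Function.Injective L := by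
    intro hinj
    have hsurj := Finite.surjective_of_injective hinj
    refine Algebra.trace_ne_zero (ZMod 2) K (LinearMap.ext fun z => ?_)
    obtain ⟨y, rfl⟩ := hsurj z
    exact hL y
  rw [injective_iff_map_eq_zero] at hnot
  push Not at hnot
  obtain ⟨y, hy, hy0⟩ := hnot
  replace hy : y + σ c * c * σ (σ y) + σ (σ c) * σ c * c * σ (σ (σ y)) = 0 := hy
  have hy1 : σ y ≠ 0 := by simpa using hy0
  have hy2 : σ (σ y) ≠ 0 := by simpa using hy0
  have hy3 : σ (σ (σ y)) ≠ 0 := by simpa using hy0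
  refine ⟨y / (c * σ y), ?_⟩
  simp only [map_div₀, map_mul]
  field_simp
  linear_combination hy

/-- The polar form of the map of Li and Kaleyski is nondegenerate up to the obvious kernel. -/
theorem eq_smul_of_polar_eq_zero (σ : K ≃ₐ[ZMod 2] K)
    (hσ : ∀ x : K, σ (σ x) * σ x * x + σ (σ x) + 1 ≠ 0)
    {x y z X Y Z : K} (hu : (x, y, z) ≠ 0)
    (h1 : σ x * X + σ X * x + σ x * Z + σ X * z + y * σ Z + Y * σ z = 0)
    (h2 : σ x * Z + σ X * z + σ y * Y + σ Y * y = 0)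
    (h3 : x * σ Y + X * σ y + σ y * Z + σ Y * z + σ z * Z + σ Z * z = 0) :
    ∃ c : K, σ c = c ∧ (X, Y, Z) = c • (x, y, z) := by
  have : CharP K 2 := charP_of_injective_algebraMap (algebraMap (ZMod 2) K).injective 2
  have two : (2 : K) = 0 := CharTwo.two_eq_zero
  obtain ⟨α, hα⟩ : ∃ α, α = y * (X + Z) + Y * (x + z) := ⟨_, rfl⟩
  obtain ⟨β, hβ⟩ : ∃ β, β = x * Z + X * z := ⟨_, rfl⟩
  obtain ⟨γ, hγ⟩ : ∃ γ, γ = z * Y + Z * y := ⟨_, rfl⟩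
  -- The combination `z * h1 + (x + z) * h2 + y * h3` eliminates `σ X`, `σ Y`, `σ Z`; exchanging the
  -- two vectors gives `o2`.
  have o1 : β * σ x + α * σ y + γ * σ z = 0 := by
    subst hα hβ hγ
    clear hσ hu
    grind
  have o2 : β * σ X + α * σ Y + γ * σ Z = 0 := by
    subst hα hβ hγ
    clear hσ hu o1
    grind
  have hσα : σ α = σ y * (σ X + σ Z) + σ Y * (σ x + σ z) := by simp [hα]
  have hσβ : σ β = σ x * σ Z + σ X * σ z := by simp [hβ]
  have hσγ : σ γ = σ z * σ Y + σ Z * σ y := by simp [hγ]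
  -- By `o1` and `o2`, `(β, α, γ)` is orthogonal to both `σ`-images, hence proportional to their
  -- cross product `(σ γ, σ β, σ α + σ γ)`; `m1`, `m2`, `m3` are the resulting minors.
  have m1 : β * (σ α + σ γ) = γ * σ γ := by
    rw [hσα, hσγ]
    linear_combination σ Y * o1 - σ y * o2 +
      (β * σ X * σ y + β * σ y * σ Z + β * σ Y * σ z - σ Y * σ z * γ) * two
  have m2 : α * σ γ = β * σ β := by
    rw [hσβ, hσγ]
    linear_combination σ Z * o1 - σ z * o2 + (α * σ z * σ Y - σ Z * β * σ x) * two
  have m3 : α * (σ α + σ γ) = γ * σ β := by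
    rw [hσα, hσγ, hσβ]
    linear_combination σ X * o1 - σ x * o2 +
      (α * σ y * σ Z + α * σ Y * σ x + α * σ Y * σ z - σ X * σ z * γ) * two
  have hγ0 : γ = 0 := by
    by_contra hne
    have hne1 : σ γ ≠ 0 := by simpa using hne
    have hne2 : σ (σ γ) ≠ 0 := by simpa using hne
    -- Eliminate `σ α` from `m1` by `σ` applied to `m2`.
    obtain ⟨x, hx⟩ := exists_root_of_exists_dual_root σ (s := β / γ) (by
      have m2' := congrArg σ m2
      simp only [map_mul] at m2'
      simp only [map_div₀]
      field_simp
      linear_combination -β * m2' + σ (σ γ) * m1 + γ * σ γ * σ (σ γ) * two)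
    exact hσ x hx
  have hβ0 : β = 0 := by simpa [hγ0] using m2.symm
  have hα0 : α = 0 := by simpa [hγ0, hβ0] using m3
  have hxZ : x * Z = X * z := by linear_combination hβ0 - hβ - X * z * two
  have hyZ : y * Z = Y * z := by linear_combination hγ0 - hγ - Y * z * two
  have hxY : x * Y = X * y := by linear_combination hα0 + hγ0 - hα - hγ - (Y * z + X * y + y * Z) * two
  obtain ⟨c, hc⟩ : ∃ c : K, (X, Y, Z) = c • (x, y, z) := by
    simp only [Prod.smul_mk, smul_eq_mul, Prod.mk.injEq]
    rcases eq_or_ne x 0 with hx | hx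
    · rcases eq_or_ne y 0 with hy | hy
      · have hz : z ≠ 0 := fun hz => hu (by rw [hx, hy, hz]; rfl)
        refine ⟨Z / z, ?_, ?_, ?_⟩ <;> field_simp
        · linear_combination -hxZ
        · linear_combination -hyZ
      · refine ⟨Y / y, ?_, ?_, ?_⟩ <;> field_simp
        · linear_combination -hxY
        · linear_combination hyZ
    · refine ⟨X / x, ?_, ?_, ?_⟩ <;> field_simp
      · linear_combination hxY
      · linear_combination hxZ
  refine ⟨c, ?_, hc⟩
  simp only [Prod.smul_mk, smul_eq_mul, Prod.mk.injEq] at hc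
  obtain ⟨rfl, rfl, rfl⟩ := hc
  by_contra hne
  simp only [map_mul] at h1 h2 h3
  have hne' : c + σ c ≠ 0 := fun h => hne (by linear_combination h - c * two)
  -- With `U = c • u` the polar form is `c + σ c` times the map at `u`, so `u` would be a nonzero
  -- zero of the map; then `y / z` contradicts (S).
  have f1 : σ x * x + σ x * z + y * σ z = 0 := by
    refine (mul_eq_zero.mp ?_).resolve_left hne'
    linear_combination h1
  have f2 : σ x * z + σ y * y = 0 := by
    refine (mul_eq_zero.mp ?_).resolve_left hne'
    linear_combination h2
  have f3 : x * σ y + σ y * z + σ z * z = 0 := by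
    refine (mul_eq_zero.mp ?_).resolve_left hne'
    linear_combination h3
  have hz : z ≠ 0 := by
    rintro rfl
    obtain rfl : y = 0 := by simpa using f2
    obtain rfl : x = 0 := by simpa using f1
    exact hu rfl
  have hy : y ≠ 0 := by
    rintro rfl
    exact hz (by simpa using f3)
  have hz1 : σ z ≠ 0 := by simpa using hz
  have hz2 : σ (σ z) ≠ 0 := by simpa using hz
  have f3' := congrArg σ f3
  simp only [map_add, map_mul, map_zero] at f3'
  refine hσ (y / z) ?_
  simp only [map_div₀]
  field_simp
  linear_combination σ (σ y) * f2 + z * f3' - σ x * z * σ (σ y) * two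

/-- The `k`-th power of the absolute Frobenius of a finite field of characteristic two. -/
theorem exists_algEquiv_eq_pow_two_pow (K : Type*) [Field K] [Fintype K] [Algebra (ZMod 2) K]
    (k : ℕ) : ∃ σ : K ≃ₐ[ZMod 2] K, ∀ x, σ x = x ^ 2 ^ k := by
  refine ⟨FiniteField.frobeniusAlgEquivOfAlgebraic (ZMod 2) K ^ k, fun x => ?_⟩
  rw [AlgEquiv.coe_pow, FiniteField.coe_frobeniusAlgEquivOfAlgebraic_iterate, ZMod.card]

/-! ### Differential uniformity. -/

/-- Two solutions of `F (w + u) - F w = v` differ by a multiple of `u` with a factor in the fixed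
field of `x ↦ x ^ 2 ^ k`. -/
theorem SingleCondition.exists_smul_eq_sub {k : ℕ} (h : SingleCondition K (2 ^ k))
    {u w w' : K × K × K} (hu : u ≠ 0)
    (hw : liKaleyskiMap K (2 ^ k) (w + u) - liKaleyskiMap K (2 ^ k) w =
      liKaleyskiMap K (2 ^ k) (w' + u) - liKaleyskiMap K (2 ^ k) w') :
    ∃ c : K, c ^ 2 ^ k = c ∧ w' - w = c • u := by
  obtain ⟨σ, hσ⟩ := exists_algEquiv_eq_pow_two_pow K k
  obtain ⟨x, y, z⟩ := u
  obtain ⟨a, b, c⟩ := w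
  obtain ⟨a', b', c'⟩ := w'
  simp only [liKaleyskiMap, pow_succ, ← hσ, Prod.mk_sub_mk, Prod.mk.injEq, map_add] at hw
  obtain ⟨e1, e2, e3⟩ := hw
  have hS : ∀ x : K, σ (σ x) * σ x * x + σ (σ x) + 1 ≠ 0 := by
    intro x
    have := h x
    rwa [pow_succ, pow_add, sq, pow_mul, ← hσ, ← hσ] at this
  simp only [← hσ]
  refine eq_smul_of_polar_eq_zero σ hS hu ?_ ?_ ?_ <;> simp only [map_sub]
  · linear_combination -e1
  · linear_combination -e2
  · linear_combination -e3

theorem SingleCondition.differentialUniformity_liKaleyskiMap {m k : ℕ}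
    (hK : Fintype.card K = 2 ^ m) (h : SingleCondition K (2 ^ k)) :
    differentialUniformity (liKaleyskiMap K (2 ^ k)) = 2 ^ Nat.gcd k m := by
  classical
  rw [← card_filter_pow_two_pow_eq_self hK k]
  apply le_antisymm
  · refine Finset.sup_le ?_
    rintro ⟨u, v⟩ huv
    have hu : u ≠ 0 := by simpa using huv
    rw [ddt]
    rcases Finset.eq_empty_or_nonempty (Finset.univ.filter fun w : K × K × K =>
      liKaleyskiMap K (2 ^ k) (w + u) - liKaleyskiMap K (2 ^ k) w = v) with he | ⟨w, hw⟩
    · simp [he]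
    · refine le_trans (Finset.card_le_card fun w' hw' => ?_)
        (Finset.card_image_le (f := fun c : K => w + c • u))
      simp only [Finset.mem_filter, Finset.mem_univ, true_and] at hw hw'
      obtain ⟨c, hc, hcu⟩ := h.exists_smul_eq_sub hu (hw.trans hw'.symm)
      simp only [Finset.mem_image, Finset.mem_filter, Finset.mem_univ, true_and]
      exact ⟨c, hc, by rw [← hcu]; abel⟩
  -- The bound is attained at `u = v = (1, 0, 0)`, where every `(c, 0, 0)` with `c` fixed by `σ` is
  -- a solution.
  · refine le_trans ?_ (Finset.le_sup (f := fun w : (K × K × K) × (K × K × K) =>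
      ddt (liKaleyskiMap K (2 ^ k)) w.1 w.2) (b := ((1, 0, 0), (1, 0, 0))) (by simp))
    refine Finset.card_le_card_of_injOn (fun c => (c, 0, 0)) (fun c hc => ?_)
      (fun c _ c' _ hcc => (Prod.mk.inj hcc).1)
    have : CharP K 2 := charP_of_injective_algebraMap (algebraMap (ZMod 2) K).injective 2
    have two : (2 : K) = 0 := CharTwo.two_eq_zero
    obtain ⟨σ, hσ⟩ := exists_algEquiv_eq_pow_two_pow K k
    simp only [Finset.coe_filter, Finset.mem_univ, true_and, Set.mem_ofPred_eq] at hc ⊢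
    rw [← hσ] at hc
    simp only [liKaleyskiMap, pow_succ, ← hσ, Prod.mk_sub_mk, map_add, map_one,
      map_zero, hc, Prod.mk.injEq]
    refine ⟨?_, by ring, by ring⟩
    linear_combination c * two

end FiniteField

end Triprojective

theorem proposition3p2 (K : Type*) [Field K] [Fintype K] [Algebra (ZMod 2) K]
    (m k : ℕ) (hK : Fintype.card K = 2 ^ m) :
    -- the map is linearly equivalent to the main map with `a = b = 1`, `c = 0`, same exponent
    Triprojective.LinearlyEquivalent (Triprojective.liKaleyskiMap K (2 ^ k))
      (Triprojective.mainMap (2 ^ k) (1 : K) 1 0) ∧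
    -- the single condition is implied by the conditions of Li and Kaleyski
    (Triprojective.LiKaleyskiConditions K (2 ^ k) → Triprojective.SingleCondition K (2 ^ k)) ∧
    -- under the single condition alone, the map is equivalent to a member of the main family
    (Triprojective.SingleCondition K (2 ^ k) → ¬ m ∣ k →
      ∃ G ∈ Triprojective.mainFamily m (1 : K) 1 0,
        Triprojective.LinearlyEquivalent (Triprojective.liKaleyskiMap K (2 ^ k)) G) ∧
    -- under the single condition alone, the differential uniformity is `2 ^ gcd (k, m)`
    (Triprojective.SingleCondition K (2 ^ k) →
      Triprojective.differentialUniformity (Triprojective.liKaleyskiMap K (2 ^ k)) =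
        2 ^ Nat.gcd k m) := by
  refine ⟨Triprojective.liKaleyskiMap_linearlyEquivalent_mainMap _, fun h => h.2.1, ?_,
    fun h => h.differentialUniformity_liKaleyskiMap hK⟩
  intro h hmk
  have hm : 0 < m := by
    rcases Nat.eq_zero_or_pos m with rfl | hm
    · exact absurd hK (Fintype.one_lt_card (α := K)).ne'
    · exact hm
  have hpow : ∀ x : K, x ^ 2 ^ k = x ^ 2 ^ (k % m) := Triprojective.pow_two_pow_mod hK k
  -- The family needs an exponent in `[1, m)`; `k % m` induces the same power map and is nonzero
  -- since `m ∤ k`.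
  refine ⟨Triprojective.mainMap (2 ^ (k % m)) 1 1 0, ⟨k % m, ?_, Nat.mod_lt _ hm, one_ne_zero,
    (h.congr hpow).mainCondition, rfl⟩, ?_⟩
  · exact Nat.pos_of_ne_zero fun h0 => hmk (Nat.dvd_of_mod_eq_zero h0)
  · rw [Triprojective.liKaleyskiMap_congr hpow]
    exact Triprojective.liKaleyskiMap_linearlyEquivalent_mainMap _
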